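/- Let $d\in\mathbb N$, let $M_n$ denote the $n\times n$ complex matrices (operators on $\mathbb C^n$), and let $\Phi:M_d\to M_d$ be a linear map. A linear map $\Phi:M_m\to M_n$ is *completely positive* (CP) if $\mathrm{id}_k\otimes\Phi$ maps positive semidefinite matrices to positive semidefinite matrices for every $k\in\mathbb N$. A *state* is a positive semidefinite matrix of trace one; a positive semidefinite $T\in M_k\otimes M_n$ is *separable* if $T=0$ or $T/\operatorname{tr}(T)$ lies in the closed convex hull of the product states $\sigma\otimes\tau$. A CP map $\Phi:M_m\to M_n$ is *entanglement breaking* (EB) if $(\mathrm{id}_k\otimes\Phi)(\rho)$ is separable for every $k\in\mathbb N$ and every state $\rho\in M_k\otimes M_m$. CP maps $\Phi:M_l\to M_m$ and $\Psi:M_l\to M_n$ are *complementary* if there is a linear map $A:\mathbb C^l\to\mathbb C^m\otimes\mathbb C^n$ such that $\Phi(T)=\operatorname{tr}_{\mathbb C^n}(ATA^*)$ and $\Psi(T)=\operatorname{tr}_{\mathbb C^m}(ATA^*)$ for all $T\in M_l$ (partial traces). A CP map $\Phi:M_l\to M_m$ is *degradable* if there are $n\in\mathbb N$ and a CP map $\Gamma:M_m\to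 M_n$ such that $\Gamma\circ\Phi$ is complementary to $\Phi$. The *adjoint* $\Phi^*$ of $\Phi:M_m\to M_n$ is the linear map $M_n\to M_m$ determined by $\operatorname{tr}(\Phi^*(X)T)=\operatorname{tr}(X\Phi(T))$ for all $X\in M_n$, $T\in M_m$. If $\Phi:M_d\to M_d$ is entanglement breaking, unital ($\Phi(I)=I$) and trace-preserving ($\operatorname{tr}\Phi(X)=\operatorname{tr}X$ for all $X\in M_d$), then $\Phi$ is degradable if and only if $\Phi^*$ is degradable. -/

import Mathlib

open scoped ComplexOrder Kronecker

namespace EBMaps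

/-- The operators on `ℂⁿ`, as `n × n` complex matrices. `ℂᵐ ⊗ ℂⁿ` is indexed by
`Fin m × Fin n`, and the tensor product of operators is the Kronecker product `⊗ₖ`. -/
abbrev Mat (n : ℕ) : Type := Matrix (Fin n) (Fin n) ℂ

/-- The operators on `ℂᵐ ⊗ ℂⁿ`. -/
abbrev Mat₂ (m n : ℕ) : Type := Matrix (Fin m × Fin n) (Fin m × Fin n) ℂ

/-- The map `id_k ⊗ Φ : M_k ⊗ M_m → M_k ⊗ M_n`: apply `Φ` to each of the `k × k` blocks. -/
def idTensor {m n : ℕ} (k : ℕ) (Φ : Mat m →ₗ[ℂ] Mat n) (X : Mat₂ k m) : Mat₂ k n :=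
  Matrix.of fun p q => Φ (Matrix.of fun a b => X (p.1, a) (q.1, b)) p.2 q.2

/-- The defining property of `id_k ⊗ Φ` on elementary tensors. -/
theorem idTensor_kronecker {m n : ℕ} (k : ℕ) (Φ : Mat m →ₗ[ℂ] Mat n) (A : Mat k) (B : Mat m) :
    idTensor k Φ (A ⊗ₖ B) = A ⊗ₖ Φ B := by
  ext p q
  have h : (Matrix.of fun a b => A p.1 q.1 * B a b : Mat m) = A p.1 q.1 • B := by
    ext a b
    simp
  simp [idTensor, Matrix.kroneckerMap_apply, h]

/-- Complete positivity: `id_k ⊗ Φ` is a positive map for every `k`. -/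
def IsCP {m n : ℕ} (Φ : Mat m →ₗ[ℂ] Mat n) : Prop :=
  ∀ (k : ℕ) (X : Mat₂ k m), X.PosSemidef → (idTensor k Φ X).PosSemidef

/-- States (density matrices): positive semidefinite of trace one. -/
def IsState {ι : Type} [Fintype ι] (ρ : Matrix ι ι ℂ) : Prop :=
  ρ.PosSemidef ∧ ρ.trace = 1

/-- Separable states on `ℂᵐ ⊗ ℂⁿ`: the closed convex hull of the product states. (All norms on
the finite-dimensional space `Mat₂ m n` induce the same topology.) -/
def separableStates (m n : ℕ) : Set (Mat₂ m n) :=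
  closure (convexHull ℝ
    {ρ | ∃ (σ : Mat m) (τ : Mat n), IsState σ ∧ IsState τ ∧ ρ = σ ⊗ₖ τ})

/-- A positive operator on `ℂᵐ ⊗ ℂⁿ` is separable if it is zero or if its normalization is a
separable state. -/
def IsSeparable {m n : ℕ} (T : Mat₂ m n) : Prop :=
  T = 0 ∨ (T.trace)⁻¹ • T ∈ separableStates m n

/-- Entanglement breaking maps: completely positive maps `Φ` such that `id_k ⊗ Φ` sends every
state, for every `k`, to a separable operator. -/
def IsEntanglementBreaking {m n : ℕ} (Φ : Mat m →ₗ[ℂ] Mat n) : Prop :=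
  IsCP Φ ∧ ∀ (k : ℕ) (ρ : Mat₂ k m), IsState ρ → IsSeparable (idTensor k Φ ρ)

/-- The partial trace over the second factor `ℂⁿ` of `ℂᵐ ⊗ ℂⁿ`. -/
def traceSnd {m n : ℕ} (X : Mat₂ m n) : Mat m :=
  Matrix.of fun a b => ∑ i, X (a, i) (b, i)

/-- The partial trace over the first factor `ℂᵐ` of `ℂᵐ ⊗ ℂⁿ`. -/
def traceFst {m n : ℕ} (X : Mat₂ m n) : Mat n :=
  Matrix.of fun i j => ∑ a, X (a, i) (a, j)

/-- `Ψ : M_l → M_n` is complementary to `Φ : M_l → M_m`: for some linear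
`A : ℂˡ → ℂᵐ ⊗ ℂⁿ`, both are the partial traces of `A T A*`. -/
def IsComplementary {l m n : ℕ} (Φ : Mat l →ₗ[ℂ] Mat m) (Ψ : Mat l →ₗ[ℂ] Mat n) : Prop :=
  IsCP Φ ∧ IsCP Ψ ∧ ∃ A : Matrix (Fin m × Fin n) (Fin l) ℂ, ∀ T : Mat l,
    Φ T = traceSnd (A * T * A.conjTranspose) ∧ Ψ T = traceFst (A * T * A.conjTranspose)

/-- `Φ` is degradable if `Γ ∘ Φ` is complementary to `Φ` for some completely positive `Γ`. -/
def IsDegradable {l m : ℕ} (Φ : Mat l →ₗ[ℂ] Mat m) : Prop :=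
  ∃ (n : ℕ) (Γ : Mat m →ₗ[ℂ] Mat n), IsCP Γ ∧ IsComplementary Φ (Γ ∘ₗ Φ)

/-- The adjoint `Φ*` of `Φ`, given by `tr (Φ*(X) T) = tr (X Φ(T))`. -/
def adjoint {m n : ℕ} (Φ : Mat m →ₗ[ℂ] Mat n) : Mat n →ₗ[ℂ] Mat m where
  toFun X := Matrix.of fun i j => (X * Φ (Matrix.single j i 1)).trace
  map_add' X Y := by
    ext i j
    simp [add_mul]
  map_smul' c X := by
    ext i j
    simp

/-- `adjoint Φ` is the unique map with `tr (Φ*(X) T) = tr (X Φ(T))`. -/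
theorem eq_adjoint_iff {m n : ℕ} (Φ : Mat m →ₗ[ℂ] Mat n) (Ψ : Mat n →ₗ[ℂ] Mat m) :
    Ψ = adjoint Φ ↔ ∀ (X : Mat n) (T : Mat m), (Ψ X * T).trace = (X * Φ T).trace := by
  constructor
  · rintro rfl X T
    conv_rhs => rw [Matrix.matrix_eq_sum_single T]
    simp only [map_sum, Matrix.mul_sum, Matrix.trace_sum]
    simp only [Matrix.trace, Matrix.diag, Matrix.mul_apply (M := adjoint Φ X)]
    rw [Finset.sum_comm]
    refine Finset.sum_congr rfl fun j _ => Finset.sum_congr rfl fun i _ => ?_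
    have h : Matrix.single j i (T j i) = T j i • Matrix.single j i (1 : ℂ) := by
      simp [Matrix.smul_single]
    change (X * Φ (Matrix.single j i 1)).trace * T j i
      = (X * Φ (Matrix.single j i (T j i))).trace
    rw [h, map_smul, Matrix.mul_smul, Matrix.trace_smul, smul_eq_mul, mul_comm]
  · intro h
    ext X i j
    change Ψ X i j = (X * Φ (Matrix.single j i 1)).trace
    rw [← h, Matrix.trace_mul_single]
    simp

end EBMaps

/-!
The heart of the matter is that a degradable, entanglement breaking, unital and trace-preserving
map has the form `Φ(T) = ∑ₖ ⟨vₖ, T vₖ⟩ wₖ wₖ*` with two orthonormal families `v` and `w`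
(`HasOrthonormalKraus`). The adjoint of such a map is obtained by exchanging `v` and `w`, and every
map of this form is degradable, because measuring its output in the basis `w` reproduces its
complement. As the adjoint of `Φ` is again unital and trace-preserving with Kraus operators of rank
one, and `Φ** = Φ`, both implications follow.

To find the form, decompose the Choi matrix of `Φ` into pure product states; a finite sum suffices,
since the convex hull of a compact set in finite dimension is closed. This gives Kraus operators
`wₖ vₖ*` (`IsEntanglementBreaking.hasRankOneKraus`). The complement of `Φ` for these operators has
the entries `⟨vₖ, T vₗ⟩ ⟨wₗ, wₖ⟩`. If `Φ` is degradable, the complement is a positive map applied to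
`Φ(T)`, and a comparison of diagonal entries shows that `wₖ ⊥ wₗ` unless `vₖ` and `vₗ` are parallel
(`IsDegradable.orthogonal_or_eq`). Grouping the terms by the line of `vₖ` and using unitality and
trace preservation yields the orthonormal form (`HasRankOneKraus.hasOrthonormalKraus`).
-/

namespace EBMaps
open Matrix

/-! ### Separable operators as finite sums of pure products -/

/-- By Carathéodory's theorem the convex hull is a finite union of continuous images of the
compact sets `stdSimplex × sⁿ`, with `n` at most the dimension plus one. -/
theorem isCompact_convexHull_of_finiteDimensional {E : Type*} [AddCommGroup E] [Module ℝ E]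
    [TopologicalSpace E] [ContinuousAdd E] [ContinuousSMul ℝ E] [FiniteDimensional ℝ E]
    {s : Set E} (hs : IsCompact s) : IsCompact (convexHull ℝ s) := by
  have key : convexHull ℝ s = ⋃ n ∈ Set.Iic (Module.finrank ℝ E + 1),
      (fun p : (Fin n → ℝ) × (Fin n → E) => ∑ i, p.1 i • p.2 i) ''
        (stdSimplex ℝ (Fin n) ×ˢ Set.univ.pi fun _ => s) := by
    ext x
    simp only [Set.mem_iUnion, Set.mem_image, Prod.exists, Set.mem_prod, Set.mem_univ_pi]
    constructor
    · intro hx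
      obtain ⟨ι, _, z, w, hz, hind, hw, hsum, rfl⟩ := eq_pos_convex_span_of_mem_convexHull hx
      have hcard := hind.card_le_finrank_succ.trans
        (Nat.succ_le_succ (Submodule.finrank_le (vectorSpan ℝ (Set.range z))))
      let e := (Fintype.equivFin ι).symm
      refine ⟨Fintype.card ι, hcard, w ∘ e, z ∘ e,
        ⟨⟨fun i => (hw _).le, ?_⟩, fun i => hz ⟨_, rfl⟩⟩, ?_⟩
      · simpa using (e.sum_comp w).trans hsum
      · exact e.sum_comp fun i => w i • z i
    · rintro ⟨n, -, w, z, ⟨hw, hz⟩, rfl⟩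
      exact mem_convexHull_of_exists_fintype w z hw.1 hw.2 hz rfl
  rw [key]
  refine (Set.finite_Iic _).isCompact_biUnion fun n _ => ?_
  exact ((isCompact_stdSimplex ℝ (Fin n)).prod (isCompact_univ_pi fun _ => hs)).image
    (by fun_prop)

theorem norm_apply_le_of_posSemidef {ι : Type*} [Fintype ι] {ρ : Matrix ι ι ℂ}
    (h : ρ.PosSemidef) (i j : ι) : ‖ρ i j‖ ≤ ‖ρ.trace‖ := by
  obtain ⟨m, v, rfl⟩ := posSemidef_iff_eq_sum_vecMulVec.mp h
  have htr : (∑ k, vecMulVec (v k) (star (v k))).trace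
      = ((∑ k, ∑ a, ‖v k a‖ ^ 2 : ℝ) : ℂ) := by
    simp [trace_sum, trace_vecMulVec, dotProduct, Complex.mul_conj']
  rw [htr, Complex.norm_of_nonneg (by positivity), Matrix.sum_apply]
  refine (norm_sum_le _ _).trans (Finset.sum_le_sum fun k _ => ?_)
  simp only [vecMulVec_apply, Pi.star_apply, norm_mul, norm_star]
  -- AM-GM: `|vᵢ vⱼ| ≤ (|vᵢ|² + |vⱼ|²) / 2 ≤ ‖v‖²`
  have hle (a : ι) : ‖v k a‖ ^ 2 ≤ ∑ a, ‖v k a‖ ^ 2 :=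
    Finset.single_le_sum (f := fun a => ‖v k a‖ ^ 2) (fun _ _ => by positivity) (Finset.mem_univ a)
  nlinarith [hle i, hle j, sq_nonneg (‖v k i‖ - ‖v k j‖)]

theorem isCompact_setOf_isState (n : ℕ) : IsCompact {ρ : Mat n | IsState ρ} := by
  have hc : IsClosed {ρ : Mat n | IsState ρ} := by
    have : {ρ : Mat n | IsState ρ} = {ρ | ρᴴ = ρ} ∩
        (⋂ x : Fin n → ℂ, {ρ | 0 ≤ star x ⬝ᵥ (ρ *ᵥ x)}) ∩ {ρ | ρ.trace = 1} := by
      ext ρ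
      simp [IsState, posSemidef_iff_dotProduct_mulVec, IsHermitian]
    rw [this]
    refine ((isClosed_eq (by fun_prop) (by fun_prop)).inter (isClosed_iInter fun x => ?_)).inter
      (isClosed_eq (by fun_prop) (by fun_prop))
    exact isClosed_le (by fun_prop) (by fun_prop)
  have hk : IsCompact (Set.univ.pi fun _ : Fin n => Set.univ.pi fun _ : Fin n =>
      Metric.closedBall (0 : ℂ) 1) :=
    isCompact_univ_pi fun _ => isCompact_univ_pi fun _ => isCompact_closedBall _ _
  refine IsCompact.of_isClosed_subset (X := Mat n) hk hc fun ρ hρ => ?_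
  intro i _ j _
  rw [mem_closedBall_zero_iff]
  have := norm_apply_le_of_posSemidef hρ.1 i j
  rwa [hρ.2, norm_one] at this

theorem isCompact_productStates (m n : ℕ) : IsCompact
    {ρ : Mat₂ m n | ∃ (σ : Mat m) (τ : Mat n), IsState σ ∧ IsState τ ∧ ρ = σ ⊗ₖ τ} := by
  have : {ρ : Mat₂ m n | ∃ (σ : Mat m) (τ : Mat n), IsState σ ∧ IsState τ ∧ ρ = σ ⊗ₖ τ}
      = (fun p : Mat m × Mat n => p.1 ⊗ₖ p.2) '' ({σ | IsState σ} ×ˢ {τ | IsState τ}) := by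
    ext ρ
    simp only [Set.mem_ofPred_eq, Set.mem_image, Prod.exists, Set.mem_prod]
    exact ⟨fun ⟨σ, τ, h1, h2, h⟩ => ⟨σ, τ, ⟨h1, h2⟩, h.symm⟩,
      fun ⟨σ, τ, ⟨h1, h2⟩, h⟩ => ⟨σ, τ, h1, h2, h.symm⟩⟩
  rw [this]
  refine ((isCompact_setOf_isState m).prod (isCompact_setOf_isState n)).image ?_
  refine continuous_matrix fun p q => ?_
  simp only [kroneckerMap_apply]
  fun_prop

/-- The closure in the definition of separable states is superfluous, so that a separable state
is a finite convex combination of product states. -/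
theorem separableStates_eq_convexHull (m n : ℕ) : separableStates m n = convexHull ℝ
    {ρ | ∃ (σ : Mat m) (τ : Mat n), IsState σ ∧ IsState τ ∧ ρ = σ ⊗ₖ τ} :=
  (isCompact_convexHull_of_finiteDimensional (isCompact_productStates m n)).isClosed.closure_eq

/-- The cone of finite sums of (unnormalized) pure product states. -/
def IsSumOfPureProducts {m n : ℕ} (T : Mat₂ m n) : Prop :=
  ∃ (ι : Type) (_ : Fintype ι) (a : ι → Fin m → ℂ) (b : ι → Fin n → ℂ),
    T = ∑ k, vecMulVec (a k) (star (a k)) ⊗ₖ vecMulVec (b k) (star (b k))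

theorem IsSumOfPureProducts.add {m n : ℕ} {S T : Mat₂ m n} (hS : IsSumOfPureProducts S)
    (hT : IsSumOfPureProducts T) : IsSumOfPureProducts (S + T) := by
  obtain ⟨ι, _, a, b, rfl⟩ := hS
  obtain ⟨κ, _, a', b', rfl⟩ := hT
  exact ⟨ι ⊕ κ, inferInstance, Sum.elim a a', Sum.elim b b', by simp⟩

theorem IsSumOfPureProducts.smul {m n : ℕ} {T : Mat₂ m n} (hT : IsSumOfPureProducts T)
    {r : ℝ} (hr : 0 ≤ r) : IsSumOfPureProducts (r • T) := by
  obtain ⟨ι, _, a, b, rfl⟩ := hT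
  refine ⟨ι, inferInstance, fun k => (Real.sqrt r : ℂ) • a k, b, ?_⟩
  rw [Finset.smul_sum]
  refine Finset.sum_congr rfl fun k _ => ?_
  ext p q
  have h : ((Real.sqrt r : ℝ) : ℂ) * (Real.sqrt r : ℝ) = r := by
    rw [← Complex.ofReal_mul, Real.mul_self_sqrt hr]
  simp only [Matrix.smul_apply, kroneckerMap_apply, vecMulVec_apply, Pi.smul_apply, Pi.star_apply,
    star_smul, smul_eq_mul, Complex.real_smul, RCLike.star_def, Complex.conj_ofReal, ← h]
  ring

theorem isSumOfPureProducts_kronecker {m n : ℕ} {σ : Mat m} {τ : Mat n} (hσ : σ.PosSemidef)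
    (hτ : τ.PosSemidef) : IsSumOfPureProducts (σ ⊗ₖ τ) := by
  obtain ⟨M, a, rfl⟩ := posSemidef_iff_eq_sum_vecMulVec.mp hσ
  obtain ⟨N, b, rfl⟩ := posSemidef_iff_eq_sum_vecMulVec.mp hτ
  refine ⟨Fin M × Fin N, inferInstance, fun k => a k.1, fun k => b k.2, ?_⟩
  ext p q
  simp [Matrix.sum_apply, kroneckerMap_apply, Finset.sum_mul_sum, Fintype.sum_prod_type]

theorem isSumOfPureProducts_of_mem_separableStates {m n : ℕ} {T : Mat₂ m n}
    (hT : T ∈ separableStates m n) : IsSumOfPureProducts T := by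
  rw [separableStates_eq_convexHull] at hT
  have hconv : Convex ℝ {T : Mat₂ m n | IsSumOfPureProducts T} :=
    fun S hS T hT r s hr hs _ => (hS.smul hr).add (hT.smul hs)
  refine convexHull_min ?_ hconv hT
  rintro _ ⟨σ, τ, hσ, hτ, rfl⟩
  exact isSumOfPureProducts_kronecker hσ.1 hτ.1

theorem IsSeparable.isSumOfPureProducts {m n : ℕ} {T : Mat₂ m n} (hT : IsSeparable T)
    (hpos : T.PosSemidef) : IsSumOfPureProducts T := by
  rcases hT with rfl | hT
  · exact ⟨Empty, inferInstance, Empty.elim, Empty.elim, by simp⟩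
  · obtain ⟨r, hr, htr⟩ : ∃ r : ℝ, 0 ≤ r ∧ (r : ℂ) = T.trace :=
      ⟨T.trace.re, (Complex.nonneg_iff.mp hpos.trace_nonneg).1,
        Complex.ext rfl (Complex.nonneg_iff.mp hpos.trace_nonneg).2⟩
    rcases eq_or_ne T.trace 0 with h0 | h0
    · rw [(hpos.trace_eq_zero_iff).mp h0]
      exact ⟨Empty, inferInstance, Empty.elim, Empty.elim, by simp⟩
    · have := (isSumOfPureProducts_of_mem_separableStates hT).smul hr
      rwa [← Complex.coe_smul, htr, smul_inv_smul₀ h0] at this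

/-! ### Kraus operators of rank one -/

/-- `Φ(T) = ∑ ⟨vₖ, T vₖ⟩ wₖ wₖ*` for finitely many vectors `vₖ`, `wₖ`, that is, `Φ` has Kraus
operators `wₖ vₖ*` of rank at most one. -/
def HasRankOneKraus {m n : ℕ} (Φ : Mat m →ₗ[ℂ] Mat n) : Prop :=
  ∃ (ι : Type) (_ : Fintype ι) (v : ι → Fin m → ℂ) (w : ι → Fin n → ℂ),
    ∀ T, Φ T = ∑ k, (star (v k) ⬝ᵥ (T *ᵥ v k)) • vecMulVec (w k) (star (w k))

/-- The vectors are read off from a decomposition of `(id ⊗ Φ)(Ω)` into pure product states,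
where `Ω` is the maximally entangled state: up to normalization, the blocks of this operator are
the values of `Φ` on the matrix units. -/
theorem IsEntanglementBreaking.hasRankOneKraus {m n : ℕ} {Φ : Mat m →ₗ[ℂ] Mat n}
    (h : IsEntanglementBreaking Φ) : HasRankOneKraus Φ := by
  rcases Nat.eq_zero_or_pos m with rfl | hm
  · refine ⟨Empty, inferInstance, Empty.elim, Empty.elim, fun T => ?_⟩
    rw [Subsingleton.elim T 0]
    simp
  -- `Ω = ∑ᵢⱼ Eᵢⱼ ⊗ Eᵢⱼ` is `m` times the maximally entangled state
  let x : Fin m × Fin m → ℂ := fun p => if p.1 = p.2 then 1 else 0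
  let Ω : Mat₂ m m := vecMulVec x (star x)
  have hm' : (m : ℂ) ≠ 0 := by exact_mod_cast hm.ne'
  have hΩ : Ω.PosSemidef := posSemidef_vecMulVec_self_star x
  have hΩs : IsState ((m : ℂ)⁻¹ • Ω) := by
    refine ⟨hΩ.smul (by simp), ?_⟩
    have : Ω.trace = m := by
      simp [Ω, x, trace_vecMulVec, dotProduct, Fintype.sum_prod_type]
    rw [trace_smul, this, smul_eq_mul, inv_mul_cancel₀ hm']
  have hsum := ((h.2 m _ hΩs).isSumOfPureProducts (h.1 m _ hΩs.1)).smul (Nat.cast_nonneg (α := ℝ) m)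
  obtain ⟨ι, _, a, b, hab⟩ := hsum
  -- the coefficient of `Eᵢⱼ` is `aᵢ āⱼ = ⟨ā, Eᵢⱼ ā⟩`, hence the conjugate
  refine ⟨ι, inferInstance, fun k => star (a k), b, fun T => ?_⟩
  have hsingle (i j : Fin m) :
      Φ (single i j 1) = ∑ k, (a k i * star (a k j)) • vecMulVec (b k) (star (b k)) := by
    ext p q
    have h1 := congrFun (congrFun hab (i, p)) (j, q)
    have h2 : (of fun c d => ((m : ℂ)⁻¹ • Ω) (i, c) (j, d) : Mat m)
        = (m : ℂ)⁻¹ • single i j 1 := by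
      ext c d
      simp only [Ω, x, of_apply, Matrix.smul_apply, vecMulVec_apply, Pi.star_apply, single_apply]
      split_ifs <;> simp_all
    have h3 : ((m : ℝ) • idTensor m Φ ((m : ℂ)⁻¹ • Ω)) (i, p) (j, q) = Φ (single i j 1) p q := by
      change (m : ℝ) • Φ (of fun c d => ((m : ℂ)⁻¹ • Ω) (i, c) (j, d)) p q = _
      rw [h2, map_smul, Matrix.smul_apply]
      simp [hm']
    rw [← h3, h1]
    simp [Matrix.sum_apply, kroneckerMap_apply, vecMulVec_apply]
  conv_lhs => rw [matrix_eq_sum_single T]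
  have h4 (i j : Fin m) : single i j (T i j) = T i j • single i j (1 : ℂ) := by
    simp [smul_single]
  simp only [map_sum, h4, map_smul, hsingle, Finset.smul_sum, smul_smul]
  rw [Finset.sum_congr rfl fun i _ => Finset.sum_comm, Finset.sum_comm]
  refine Finset.sum_congr rfl fun k _ => ?_
  simp only [← Finset.sum_smul, dotProduct, mulVec, Finset.mul_sum, Pi.star_apply, star_star]
  congr 1
  refine Finset.sum_congr rfl fun i _ => Finset.sum_congr rfl fun j _ => by ring

theorem vecMulVec_mul_mul_conjTranspose {m n : ℕ} (v : Fin m → ℂ) (w : Fin n → ℂ) (T : Mat m) :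
    vecMulVec w (star v) * T * (vecMulVec w (star v))ᴴ
      = (star v ⬝ᵥ (T *ᵥ v)) • vecMulVec w (star w) := by
  rw [conjTranspose_vecMulVec, star_star, vecMulVec_mul, vecMulVec_mul_vecMulVec,
    ← dotProduct_mulVec, vecMulVec_smul]

theorem HasRankOneKraus.isCP {m n : ℕ} {Φ : Mat m →ₗ[ℂ] Mat n} (h : HasRankOneKraus Φ) :
    IsCP Φ := by
  obtain ⟨ι, _, v, w, hΦ⟩ := h
  intro k X hX
  have : idTensor k Φ X = ∑ i, ((1 : Mat k) ⊗ₖ vecMulVec (w i) (star (v i))) * X *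
      ((1 : Mat k) ⊗ₖ vecMulVec (w i) (star (v i)))ᴴ := by
    ext p q
    rw [Matrix.sum_apply]
    simp only [idTensor, hΦ, of_apply, Matrix.sum_apply]
    refine Finset.sum_congr rfl fun i _ => ?_
    simp only [mul_apply, Fintype.sum_prod_type, conjTranspose_apply, kroneckerMap_apply,
      one_apply, ite_mul, one_mul, zero_mul, Finset.sum_ite_irrel, Finset.sum_const_zero,
      Finset.sum_ite_eq, Finset.mem_univ, if_true, apply_ite star, star_zero, mul_ite, mul_zero]
    simp only [Matrix.smul_apply, vecMulVec_apply, Pi.star_apply, dotProduct, mulVec, of_apply,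
      smul_eq_mul, Finset.sum_mul, Finset.mul_sum, star_mul', star_star]
    rw [Finset.sum_comm]
    refine Finset.sum_congr rfl fun a _ => Finset.sum_congr rfl fun b _ => by ring
  rw [this]
  exact posSemidef_sum _ fun i _ => hX.mul_mul_conjTranspose_same _

theorem IsCP.comp {l m n : ℕ} {Ψ : Mat m →ₗ[ℂ] Mat n} {Φ : Mat l →ₗ[ℂ] Mat m} (hΨ : IsCP Ψ)
    (hΦ : IsCP Φ) : IsCP (Ψ ∘ₗ Φ) :=
  fun k X hX => hΨ k _ (hΦ k X hX)

theorem IsCP.map_posSemidef {m n : ℕ} {Φ : Mat m →ₗ[ℂ] Mat n} (h : IsCP Φ) {X : Mat m}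
    (hX : X.PosSemidef) : (Φ X).PosSemidef :=
  (h 1 (X.submatrix Prod.snd Prod.snd) (hX.submatrix _)).submatrix fun a => (0, a)

/-! ### Orthonormal output vectors imply degradability -/

/-- The map `X ↦ ∑ₖ ⟨vₖ, X vₖ⟩ |k⟩⟨k|`, which for an orthonormal basis `v` is the measurement in
that basis with classical outcome `k`. -/
noncomputable def measurement {m N : ℕ} (v : Fin N → Fin m → ℂ) : Mat m →ₗ[ℂ] Mat N where
  toFun X := diagonal fun k => star (v k) ⬝ᵥ (X *ᵥ v k)
  map_add' X Y := by
    ext i j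
    simp [diagonal_apply, add_mulVec, dotProduct_add]
    split_ifs <;> simp
  map_smul' c X := by
    ext i j
    simp [diagonal_apply, smul_mulVec, dotProduct_smul]

theorem hasRankOneKraus_measurement {m N : ℕ} (v : Fin N → Fin m → ℂ) :
    HasRankOneKraus (measurement v) := by
  refine ⟨Fin N, inferInstance, v, fun k => Pi.single k 1, fun T => ?_⟩
  ext i j
  simp [measurement, Matrix.sum_apply, vecMulVec_apply, diagonal_apply, Pi.single_apply]
  grind

/-- With `wₖ` orthonormal, the complement of `Φ` for the Kraus operators `wₖ vₖ*` has the entries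
`⟨vₖ, T vₗ⟩ ⟨wₗ, wₖ⟩`, so it is diagonal, and measuring `Φ(T)` along the `wₖ` yields it. -/
theorem isDegradable_of_orthonormal {m n N : ℕ} {Φ : Mat m →ₗ[ℂ] Mat n} {v : Fin N → Fin m → ℂ}
    {w : Fin N → Fin n → ℂ} (hw : ∀ k l, star (w k) ⬝ᵥ w l = if k = l then 1 else 0)
    (hΦ : ∀ T, Φ T = ∑ k, (star (v k) ⬝ᵥ (T *ᵥ v k)) • vecMulVec (w k) (star (w k))) :
    IsDegradable Φ := by
  have hCP : IsCP Φ := HasRankOneKraus.isCP ⟨Fin N, inferInstance, v, w, hΦ⟩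
  have hΓ := (hasRankOneKraus_measurement w).isCP
  refine ⟨N, measurement w, hΓ, hCP, hΓ.comp hCP,
    of fun p x => w p.2 p.1 * star (v p.2 x), fun T => ⟨?_, ?_⟩⟩
  · ext a b
    simp only [hΦ, traceSnd, of_apply, Matrix.sum_apply]
    refine Finset.sum_congr rfl fun k _ => ?_
    rw [← vecMulVec_mul_mul_conjTranspose]
    rfl
  · have hcoef (k : Fin N) : star (w k) ⬝ᵥ (Φ T *ᵥ w k) = star (v k) ⬝ᵥ (T *ᵥ v k) := by
      simp [hΦ, sum_mulVec, smul_mulVec, vecMulVec_mulVec, dotProduct_smul, hw]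
    ext k l
    have hT : traceFst ((of fun p x => w p.2 p.1 * star (v p.2 x) :
        Matrix (Fin n × Fin N) (Fin m) ℂ) * T * (of fun p x => w p.2 p.1 * star (v p.2 x))ᴴ) k l
        = (star (v k) ⬝ᵥ (T *ᵥ v l)) * (star (w l) ⬝ᵥ w k) := by
      simp only [traceFst, of_apply, mul_apply, conjTranspose_apply, dotProduct, mulVec,
        star_mul', star_star, Finset.sum_mul, Finset.mul_sum, Pi.star_apply]
      refine Finset.sum_congr rfl fun a _ => ?_
      rw [Finset.sum_comm]
      refine Finset.sum_congr rfl fun x _ => Finset.sum_congr rfl fun y _ => by ring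
    rw [hT, hw]
    simp only [measurement, LinearMap.comp_apply, LinearMap.coe_mk, AddHom.coe_mk,
      diagonal_apply, hcoef, eq_comm (a := l)]
    split_ifs with h
    · rw [h, mul_one]
    · rw [mul_zero]

/-! ### The complement of a degradable map -/

/-- Two factorizations of one positive matrix: the columns of `B` lie in the span of those of
`A`. Applied to vectorized Kraus operators, this relates two Kraus decompositions of a map. -/
theorem exists_eq_mul_of_mul_conjTranspose_eq {p n κ : Type*} [Fintype p] [Fintype n]
    [Fintype κ] {A : Matrix p n ℂ} {B : Matrix p κ ℂ} (h : A * Aᴴ = B * Bᴴ) :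
    ∃ U : Matrix n κ ℂ, B = A * U := by
  classical
  have hk (k : κ) : ∃ c : n → ℂ, ∑ i, c i • (dotProductBilin ℂ ℂ (Aᵀ i) : (p → ℂ) →ₗ[ℂ] ℂ)
      = dotProductBilin ℂ ℂ (Bᵀ k) := by
    rw [← Submodule.mem_span_range_iff_exists_fun]
    refine mem_span_of_iInf_ker_le_ker fun x hx => ?_
    simp only [Submodule.mem_iInf, LinearMap.mem_ker, dotProductBilin_apply_apply] at hx ⊢
    have hA : Aᴴ *ᵥ star x = 0 := by
      ext i
      have := congrArg star (hx i)
      simpa [mulVec, dotProduct, conjTranspose_apply, transpose_apply] using this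
    have hB : Bᴴ *ᵥ star x = 0 := by
      rw [← self_mul_conjTranspose_mulVec_eq_zero, ← h, self_mul_conjTranspose_mulVec_eq_zero, hA]
    have := congrArg star (congrFun hB k)
    simpa [mulVec, dotProduct, conjTranspose_apply, transpose_apply] using this
  choose c hc using hk
  refine ⟨of fun i k => c k i, ?_⟩
  ext q k
  have := LinearMap.congr_fun (hc k) (Pi.single q 1)
  simp only [LinearMap.sum_apply, LinearMap.smul_apply, dotProductBilin_apply_apply,
    dotProduct_single_one, transpose_apply, smul_eq_mul] at this
  rw [← this, mul_apply]
  exact Finset.sum_congr rfl fun i _ => mul_comm _ _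

/-- If `Φ` is degradable, then its complement for the given Kraus operators `wₖ vₖ*`, which has
the entries `⟨vₖ, T vₗ⟩ ⟨wₗ, wₖ⟩`, also factors through `Φ` via a positive map; `G j` is the value
of that map at `wⱼ wⱼ*`. -/
theorem IsDegradable.exists_posSemidef {m n : ℕ} {Φ : Mat m →ₗ[ℂ] Mat n} (hdeg : IsDegradable Φ)
    {ι : Type*} [Fintype ι] {v : ι → Fin m → ℂ} {w : ι → Fin n → ℂ}
    (hΦ : ∀ T, Φ T = ∑ k, (star (v k) ⬝ᵥ (T *ᵥ v k)) • vecMulVec (w k) (star (w k))) :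
    ∃ G : ι → Matrix ι ι ℂ, (∀ j, (G j).PosSemidef) ∧ ∀ T k l,
      (star (v k) ⬝ᵥ (T *ᵥ v l)) * (star (w l) ⬝ᵥ w k)
        = ∑ j, (star (v j) ⬝ᵥ (T *ᵥ v j)) * G j k l := by
  obtain ⟨N, Γ, hΓ, -, -, A, hA⟩ := hdeg
  -- `A'` and `B` have the vectorized Kraus operators as columns; both products are the Choi
  -- matrix of `Φ`
  let A' : Matrix (Fin n × Fin m) (Fin N) ℂ := of fun p i => A (p.1, i) p.2
  let B : Matrix (Fin n × Fin m) ι ℂ := of fun p k => w k p.1 * star (v k p.2)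
  have hAB : A' * A'ᴴ = B * Bᴴ := by
    ext ⟨a, x⟩ ⟨b, y⟩
    have h1 := congrFun (congrFun ((hA (single x y 1)).1.symm.trans (hΦ _)) a) b
    simp only [traceSnd, of_apply, Matrix.sum_apply] at h1
    simp only [mul_apply, A', B, of_apply, conjTranspose_apply]
    convert h1 using 1
    · refine Finset.sum_congr rfl fun i _ => ?_
      simp [single_apply, mul_apply, ite_and, Finset.sum_ite_eq]
    · refine Finset.sum_congr rfl fun k _ => ?_
      simp [single_mulVec, vecMulVec_apply, dotProduct_single,
        show Function.update (0 : Fin m → ℂ) x (v k y) = Pi.single x (v k y) from rfl]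
      ring
  obtain ⟨U, hU⟩ := exists_eq_mul_of_mul_conjTranspose_eq hAB
  refine ⟨fun j => Uᵀ * Γ (vecMulVec (w j) (star (w j))) * Uᵀᴴ, fun j =>
    (hΓ.map_posSemidef (posSemidef_vecMulVec_self_star _)).mul_mul_conjTranspose_same _,
    fun T k l => ?_⟩
  have h1 : (Uᵀ * Γ (Φ T) * Uᵀᴴ) k l = ∑ j, (star (v j) ⬝ᵥ (T *ᵥ v j)) *
      (Uᵀ * Γ (vecMulVec (w j) (star (w j))) * Uᵀᴴ) k l := by
    rw [hΦ]
    simp [Matrix.mul_sum, Matrix.sum_mul, Matrix.sum_apply]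
  have h2 : Γ (Φ T) = ∑ a, (of fun i x => A (a, i) x) * T * (of fun i x => A (a, i) x)ᴴ := by
    ext i j
    rw [← LinearMap.comp_apply, (hA T).2, Matrix.sum_apply]
    rfl
  have h3 (a : Fin n) : Uᵀ * (of fun i x => A (a, i) x) = of fun k x => w k a * star (v k x) := by
    ext k x
    have := congrFun (congrFun hU (a, x)) k
    simp only [B, A', mul_apply, of_apply, transpose_apply] at this ⊢
    rw [this]
    exact Finset.sum_congr rfl fun i _ => mul_comm _ _
  have h4 : Uᵀ * Γ (Φ T) * Uᵀᴴ = ∑ a, (of fun k x => w k a * star (v k x)) * T *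
      (of fun k x => w k a * star (v k x))ᴴ := by
    rw [h2, Matrix.mul_sum, Matrix.sum_mul]
    refine Finset.sum_congr rfl fun a _ => ?_
    rw [← h3, conjTranspose_mul]
    simp only [Matrix.mul_assoc]
  rw [← h1, h4, Matrix.sum_apply]
  simp only [of_apply, mul_apply, conjTranspose_apply, dotProduct, mulVec,
    star_mul', star_star, Finset.sum_mul, Finset.mul_sum, Pi.star_apply]
  refine Finset.sum_congr rfl fun a _ => ?_
  rw [Finset.sum_comm]
  refine Finset.sum_congr rfl fun x _ => Finset.sum_congr rfl fun y _ => by ring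

/-! ### Projections and unit vectors -/

theorem dotProduct_mulVec_eq_trace {m : ℕ} (v : Fin m → ℂ) (T : Mat m) :
    star v ⬝ᵥ (T *ᵥ v) = (vecMulVec v (star v) * T).trace := by
  rw [vecMulVec_mul, trace_vecMulVec, dotProduct_mulVec, dotProduct_comm]

theorem trace_vecMulVec_mul_vecMulVec {m : ℕ} (a b : Fin m → ℂ) :
    (vecMulVec a (star a) * vecMulVec b (star b)).trace
      = star (star a ⬝ᵥ b) * (star a ⬝ᵥ b) := by
  rw [← dotProduct_mulVec_eq_trace, vecMulVec_mulVec, op_smul_eq_smul, dotProduct_smul,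
    smul_eq_mul, star_dotProduct]

theorem vecMulVec_mul_self {m : ℕ} {v : Fin m → ℂ} (hv : star v ⬝ᵥ v = 1) :
    vecMulVec v (star v) * vecMulVec v (star v) = vecMulVec v (star v) := by
  rw [vecMulVec_mul_vecMulVec, hv, one_smul]

theorem isHermitian_vecMulVec {m : ℕ} (v : Fin m → ℂ) : (vecMulVec v (star v)).IsHermitian :=
  (posSemidef_vecMulVec_self_star v).isHermitian

theorem posSemidef_of_isHermitian_of_mul_self {m : ℕ} {Q : Mat m} (h : Q.IsHermitian)
    (hQ : Q * Q = Q) : Q.PosSemidef := by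
  have := posSemidef_conjTranspose_mul_self Q
  rwa [h.eq, hQ] at this

theorem apply_eq_zero_of_posSemidef {ι : Type*} [Fintype ι] {G : Matrix ι ι ℂ}
    (hG : G.PosSemidef) {k l : ι} (h : G k k = 0 ∨ G l l = 0) : G k l = 0 := by
  classical
  have key (a b : ι) (ha : G a a = 0) : G b a = 0 := by
    have := (hG.dotProduct_mulVec_zero_iff (Pi.single a 1)).mp (by simpa [Pi.star_single] using ha)
    simpa using congrFun this b
  rcases h with h | h
  · rw [← hG.isHermitian.apply k l, key k l h, star_zero]
  · exact key l k h

theorem exists_smul_unit {m : ℕ} {v : Fin m → ℂ} (hv : v ≠ 0) :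
    ∃ (r : ℂ) (u : Fin m → ℂ), r ≠ 0 ∧ star u ⬝ᵥ u = 1 ∧ v = r • u := by
  have hpos : 0 < star v ⬝ᵥ v := dotProduct_star_self_pos_iff.mpr hv
  obtain ⟨hre, him⟩ := Complex.pos_iff.mp hpos
  set r : ℝ := Real.sqrt (star v ⬝ᵥ v).re
  have hr : (r : ℂ) ≠ 0 := by exact_mod_cast (Real.sqrt_pos.mpr hre).ne'
  have hrr : (r : ℂ) * r = star v ⬝ᵥ v := by
    rw [← Complex.ofReal_mul, Real.mul_self_sqrt hre.le]
    exact Complex.ext rfl him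
  refine ⟨r, (r : ℂ)⁻¹ • v, hr, ?_, by rw [smul_inv_smul₀ hr]⟩
  rw [star_smul, smul_dotProduct, dotProduct_smul, ← hrr]
  simp [hr]

/-- A nonzero projection of trace at most one has rank one: for a unit vector `e` in its range,
subtracting `e e*` leaves a projection of nonpositive trace. -/
theorem exists_eq_vecMulVec_of_trace_le_one {m : ℕ} {R : Mat m} (hH : R.IsHermitian)
    (hR : R * R = R) (h0 : R ≠ 0) (htr : R.trace ≤ 1) :
    ∃ e : Fin m → ℂ, star e ⬝ᵥ e = 1 ∧ R = vecMulVec e (star e) := by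
  obtain ⟨x, hx⟩ : ∃ x, R *ᵥ x ≠ 0 := by
    by_contra! h
    exact h0 (Matrix.ext_of_mulVec_single fun i => by rw [h, zero_mulVec])
  obtain ⟨r, e, hr, he, hre⟩ := exists_smul_unit hx
  have hRe : R *ᵥ e = e := by
    have h1 : R *ᵥ (R *ᵥ x) = R *ᵥ x := by rw [mulVec_mulVec, hR]
    rw [hre, mulVec_smul] at h1
    exact smul_right_injective _ hr h1
  have hRE : R * vecMulVec e (star e) = vecMulVec e (star e) := by
    rw [mul_vecMulVec, hRe]
  have hER : vecMulVec e (star e) * R = vecMulVec e (star e) := by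
    have := congrArg conjTranspose hRE
    rwa [conjTranspose_mul, hH.eq, (isHermitian_vecMulVec e).eq] at this
  have hpsd : (R - vecMulVec e (star e)).PosSemidef := by
    refine posSemidef_of_isHermitian_of_mul_self (hH.sub (isHermitian_vecMulVec e)) ?_
    rw [sub_mul, mul_sub, mul_sub, hR, hRE, hER, vecMulVec_mul_self he]
    simp
  refine ⟨e, he, sub_eq_zero.mp (hpsd.trace_eq_zero_iff.mp (le_antisymm ?_ hpsd.trace_nonneg))⟩
  rw [trace_sub, trace_vecMulVec, dotProduct_comm, he]
  exact sub_nonpos.mpr htr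

/-! ### Structure of degradable maps -/

theorem HasRankOneKraus.exists_unit {m n : ℕ} {Φ : Mat m →ₗ[ℂ] Mat n} (h : HasRankOneKraus Φ) :
    ∃ (ι : Type) (_ : Fintype ι) (v : ι → Fin m → ℂ) (w : ι → Fin n → ℂ),
      (∀ k, star (v k) ⬝ᵥ v k = 1) ∧
      ∀ T, Φ T = ∑ k, (star (v k) ⬝ᵥ (T *ᵥ v k)) • vecMulVec (w k) (star (w k)) := by
  classical
  obtain ⟨ι, _, v, w, hΦ⟩ := h
  have hv (k : {k // v k ≠ 0}) := exists_smul_unit k.2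
  choose r u hr hu hvu using hv
  refine ⟨{k // v k ≠ 0}, inferInstance, u, fun k => r k • w k, hu, fun T => ?_⟩
  rw [hΦ, ← Finset.sum_filter_of_ne (p := fun k => v k ≠ 0), ← Finset.sum_subtype_eq_sum_filter,
    Finset.subtype_univ]
  · refine Finset.sum_congr rfl fun k _ => ?_
    rw [hvu k]
    simp only [star_smul, smul_dotProduct, mulVec_smul, dotProduct_smul, smul_vecMulVec,
      vecMulVec_smul, smul_smul, smul_eq_mul]
    congr 1
    ring
  · rintro k - hk h0
    simp [h0] at hk

/-- The crucial consequence of degradability. The diagonal of the complement gives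
`‖wₖ‖² vₖ vₖ* = ∑ⱼ (Gⱼ)ₖₖ vⱼ vⱼ*`, and as the left side has rank one, `(Gⱼ)ₖₖ ≠ 0` forces `vⱼ` to be
parallel to `vₖ`. If `vₖ` and `vₗ` are not parallel, then all `(Gⱼ)ₖₗ` vanish by positivity, and the
entry `⟨vₖ, T vₗ⟩ ⟨wₗ, wₖ⟩` of the complement is zero for every `T`. Equality of the projections
onto two unit vectors expresses that they are parallel. -/
theorem IsDegradable.orthogonal_or_eq {m n : ℕ} {Φ : Mat m →ₗ[ℂ] Mat n} (hdeg : IsDegradable Φ)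
    {ι : Type*} [Fintype ι] {v : ι → Fin m → ℂ} {w : ι → Fin n → ℂ}
    (hv : ∀ k, star (v k) ⬝ᵥ v k = 1)
    (hΦ : ∀ T, Φ T = ∑ k, (star (v k) ⬝ᵥ (T *ᵥ v k)) • vecMulVec (w k) (star (w k))) (k l : ι) :
    star (w k) ⬝ᵥ w l = 0 ∨ vecMulVec (v k) (star (v k)) = vecMulVec (v l) (star (v l)) := by
  obtain ⟨G, hG, hGT⟩ := hdeg.exists_posSemidef hΦ
  have key (j k : ι) (h : G j k k ≠ 0) :
      vecMulVec (v j) (star (v j)) = vecMulVec (v k) (star (v k)) := by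
    set Q : Mat m := 1 - vecMulVec (v k) (star (v k)) with hQ
    have hQpos : Q.PosSemidef := by
      refine posSemidef_of_isHermitian_of_mul_self (isHermitian_one.sub (isHermitian_vecMulVec _)) ?_
      rw [sub_mul, mul_sub, mul_sub, vecMulVec_mul_self (hv k)]
      simp [hQ]
    have hQk : Q *ᵥ v k = 0 := by
      rw [hQ, sub_mulVec, vecMulVec_mulVec, hv]
      simp
    -- the identity for the diagonal entry `k`, evaluated at the projection onto `vₖ⊥`
    have hsum := hGT Q k k
    rw [hQk, dotProduct_zero, zero_mul, eq_comm, Finset.sum_eq_zero_iff_of_nonneg fun i _ =>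
      mul_nonneg (hQpos.dotProduct_mulVec_nonneg _) (hG i).diag_nonneg] at hsum
    have hj := (mul_eq_zero.mp (hsum j (Finset.mem_univ j))).resolve_right h
    rw [hQpos.dotProduct_mulVec_zero_iff, hQ, sub_mulVec, vecMulVec_mulVec, one_mulVec,
      op_smul_eq_smul, sub_eq_zero] at hj
    have hc := hv j
    rw [hj, star_smul, smul_dotProduct, dotProduct_smul, hv k] at hc
    rw [hj, star_smul, smul_vecMulVec, vecMulVec_smul, smul_smul]
    simp only [smul_eq_mul, mul_one] at hc
    rw [mul_comm, hc, one_smul]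
  by_cases hkl : vecMulVec (v k) (star (v k)) = vecMulVec (v l) (star (v l))
  · exact Or.inr hkl
  refine Or.inl ?_
  have h0 (j : ι) : G j l k = 0 := by
    refine apply_eq_zero_of_posSemidef (hG j) ?_
    by_contra! h
    exact hkl ((key j k h.2).symm.trans (key j l h.1))
  have := hGT (vecMulVec (v l) (star (v k))) l k
  simpa [h0, vecMulVec_mulVec, hv] using this

/-- `Φ` has the form `Φ(T) = ∑ₖ ⟨vₖ, T vₖ⟩ wₖ wₖ*` for two orthonormal families `v`, `w`. -/
def HasOrthonormalKraus {m n : ℕ} (Φ : Mat m →ₗ[ℂ] Mat n) : Prop :=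
  ∃ (N : ℕ) (v : Fin N → Fin m → ℂ) (w : Fin N → Fin n → ℂ),
    (∀ k l, star (v k) ⬝ᵥ v l = if k = l then 1 else 0) ∧
    (∀ k l, star (w k) ⬝ᵥ w l = if k = l then 1 else 0) ∧
    ∀ T, Φ T = ∑ k, (star (v k) ⬝ᵥ (T *ᵥ v k)) • vecMulVec (w k) (star (w k))

theorem dotProduct_eq_zero_of_trace_eq_zero {m : ℕ} {a b : Fin m → ℂ}
    (h : (vecMulVec a (star a) * vecMulVec b (star b)).trace = 0) : star a ⬝ᵥ b = 0 := by
  rw [trace_vecMulVec_mul_vecMulVec, mul_eq_zero, star_eq_zero, or_self] at h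
  exact h

theorem trace_mul_nonneg_of_vecMulVec {m : ℕ} (a b : Fin m → ℂ) :
    0 ≤ (vecMulVec a (star a) * vecMulVec b (star b)).trace := by
  rw [trace_vecMulVec_mul_vecMulVec]
  exact star_mul_self_nonneg _

/-- Collecting the terms with the same projection `Q` onto a line gives
`Φ(T) = ∑ tr(Q T) R_Q`, where the `R_Q` are positive with `R_Q R_Q' = 0` for `Q ≠ Q'`.
Unitality says `∑ R_Q = 1`, so the `R_Q` are projections; trace preservation says
`∑ tr(R_Q) Q = 1`, so each nonzero `R_Q` has rank one and the corresponding `Q` are orthogonal. -/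
theorem HasRankOneKraus.hasOrthonormalKraus {m n : ℕ} {Φ : Mat m →ₗ[ℂ] Mat n}
    (h : HasRankOneKraus Φ) (hdeg : IsDegradable Φ) (hunital : Φ 1 = 1)
    (htrace : ∀ X : Mat m, (Φ X).trace = X.trace) : HasOrthonormalKraus Φ := by
  classical
  obtain ⟨ι, _, v, w, hv, hΦ⟩ := h.exists_unit
  have horth := hdeg.orthogonal_or_eq hv hΦ
  let P : ι → Mat m := fun k => vecMulVec (v k) (star (v k))
  let s : Finset (Mat m) := Finset.univ.image P
  let R : Mat m → Mat n := fun Q => ∑ k with P k = Q, vecMulVec (w k) (star (w k))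
  have hs (Q : Mat m) (hQ : Q ∈ s) :
      ∃ u : Fin m → ℂ, star u ⬝ᵥ u = 1 ∧ Q = vecMulVec u (star u) := by
    obtain ⟨k, -, rfl⟩ := Finset.mem_image.mp hQ
    exact ⟨v k, hv k, rfl⟩
  have htrQ (Q : Mat m) (hQ : Q ∈ s) : Q.trace = 1 := by
    obtain ⟨u, hu, rfl⟩ := hs Q hQ
    rw [trace_vecMulVec, dotProduct_comm, hu]
  have hR (Q : Mat m) : (R Q).PosSemidef :=
    posSemidef_sum _ fun k _ => posSemidef_vecMulVec_self_star _
  have hRR (Q Q' : Mat m) (hne : Q ≠ Q') : R Q * R Q' = 0 := by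
    simp only [R, Finset.sum_mul, Finset.mul_sum]
    refine Finset.sum_eq_zero fun k hk => Finset.sum_eq_zero fun l hl => ?_
    rw [Finset.mem_filter_univ] at hk hl
    have : star (w l) ⬝ᵥ w k = 0 :=
      (horth l k).resolve_right fun h => hne (hl.symm.trans (h.trans hk))
    rw [vecMulVec_mul_vecMulVec, this, zero_smul, vecMulVec_zero]
  have hΦs (T : Mat m) : Φ T = ∑ Q ∈ s, (Q * T).trace • R Q := by
    rw [hΦ, ← Finset.sum_fiberwise_of_maps_to (g := P) (t := s)
      fun k _ => Finset.mem_image_of_mem P (Finset.mem_univ k)]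
    refine Finset.sum_congr rfl fun Q _ => ?_
    rw [Finset.smul_sum]
    refine Finset.sum_congr rfl fun k hk => ?_
    rw [dotProduct_mulVec_eq_trace, ← (Finset.mem_filter_univ _).mp hk]
  have hone : ∑ Q ∈ s, R Q = 1 := by
    rw [← hunital, hΦs]
    exact Finset.sum_congr rfl fun Q hQ => by rw [mul_one, htrQ Q hQ, one_smul]
  have hidem (Q : Mat m) (hQ : Q ∈ s) : R Q * R Q = R Q := by
    have := congrArg (R Q * ·) hone
    simp only [Finset.mul_sum, mul_one] at this
    rwa [Finset.sum_eq_single_of_mem Q hQ fun Q' _ hne => hRR Q Q' hne.symm] at this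
  have htr1 (T : Mat m) : ∑ Q ∈ s, (Q * T).trace * (R Q).trace = T.trace := by
    rw [← htrace, hΦs, trace_sum]
    simp
  have hnn (Q Q' : Mat m) (hQ : Q ∈ s) (hQ' : Q' ∈ s) : 0 ≤ (Q' * Q).trace * (R Q').trace := by
    obtain ⟨u, -, rfl⟩ := hs Q hQ
    obtain ⟨u', -, rfl⟩ := hs Q' hQ'
    exact mul_nonneg (trace_mul_nonneg_of_vecMulVec _ _) (hR _).trace_nonneg
  have hself (Q : Mat m) (hQ : Q ∈ s) : (Q * Q).trace = 1 := by
    obtain ⟨u, hu, rfl⟩ := hs Q hQ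
    rw [trace_vecMulVec_mul_vecMulVec, hu, star_one, one_mul]
  have hle (Q : Mat m) (hQ : Q ∈ s) : (R Q).trace ≤ 1 := by
    have := Finset.single_le_sum (fun Q' hQ' => hnn Q Q' hQ hQ') hQ
    rwa [hself Q hQ, one_mul, htr1, htrQ Q hQ] at this
  -- terms with `R Q = 0` (all `wₖ` zero) carry no unit vector and are dropped
  let t : Finset (Mat m) := s.filter fun Q => R Q ≠ 0
  have ht (Q : t) : Q.1 ∈ s ∧ R Q.1 ≠ 0 := Finset.mem_filter.mp Q.2
  have hu (Q : t) := hs Q.1 (ht Q).1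
  have he (Q : t) := exists_eq_vecMulVec_of_trace_le_one (hR Q.1).isHermitian
    (hidem Q.1 (ht Q).1) (ht Q).2 (hle Q.1 (ht Q).1)
  choose u hu hQu using hu
  choose e he hRe using he
  have hRtr (Q : t) : (R Q.1).trace = 1 := by
    rw [hRe, trace_vecMulVec, dotProduct_comm, he]
  have huv (Q Q' : t) (hne : Q ≠ Q') : star (u Q) ⬝ᵥ u Q' = 0 := by
    have h1 := htr1 Q'.1
    rw [← Finset.add_sum_erase _ _ (ht Q').1, hself _ (ht Q').1, htrQ _ (ht Q').1, hRtr, one_mul,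
      add_eq_left, Finset.sum_eq_zero_iff_of_nonneg fun Q'' h =>
        hnn _ _ (ht Q').1 (Finset.mem_of_mem_erase h)] at h1
    have h2 := h1 Q.1 (Finset.mem_erase.mpr ⟨fun h => hne (Subtype.ext h), (ht Q).1⟩)
    rw [hRtr, mul_one, hQu Q, hQu Q'] at h2
    exact dotProduct_eq_zero_of_trace_eq_zero h2
  have hew (Q Q' : t) (hne : Q ≠ Q') : star (e Q) ⬝ᵥ e Q' = 0 := by
    have h1 := hRR Q.1 Q'.1 fun h => hne (Subtype.ext h)
    rw [hRe, hRe] at h1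
    exact dotProduct_eq_zero_of_trace_eq_zero (by rw [h1, trace_zero])
  let f := (Fintype.equivFin t).symm
  refine ⟨Fintype.card t, u ∘ f, e ∘ f, fun k l => ?_, fun k l => ?_, fun T => ?_⟩
  · split_ifs with hkl
    · rw [hkl]; exact hu _
    · exact huv _ _ fun h => hkl (f.injective h)
  · split_ifs with hkl
    · rw [hkl]; exact he _
    · exact hew _ _ fun h => hkl (f.injective h)
  · simp only [Function.comp_apply]
    rw [f.sum_comp fun Q => (star (u Q) ⬝ᵥ (T *ᵥ u Q)) • vecMulVec (e Q) (star (e Q)), hΦs,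
      ← Finset.sum_filter_of_ne (p := fun Q => R Q ≠ 0), ← Finset.sum_coe_sort]
    · refine Finset.sum_congr rfl fun Q _ => ?_
      rw [dotProduct_mulVec_eq_trace, ← hQu, ← hRe]
    · rintro Q - hQ h0
      simp [h0] at hQ

/-! ### Adjoints -/

theorem adjoint_apply_of_kraus {m n : ℕ} {Φ : Mat m →ₗ[ℂ] Mat n}
    {ι : Type*} [Fintype ι] {v : ι → Fin m → ℂ} {w : ι → Fin n → ℂ}
    (hΦ : ∀ T, Φ T = ∑ k, (star (v k) ⬝ᵥ (T *ᵥ v k)) • vecMulVec (w k) (star (w k))) (X : Mat n) :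
    adjoint Φ X = ∑ k, (star (w k) ⬝ᵥ (X *ᵥ w k)) • vecMulVec (v k) (star (v k)) := by
  ext i j
  change (X * Φ (single j i 1)).trace = _
  rw [hΦ, Matrix.mul_sum, trace_sum, Matrix.sum_apply]
  refine Finset.sum_congr rfl fun k _ => ?_
  rw [Matrix.mul_smul, trace_smul, trace_mul_comm, ← dotProduct_mulVec_eq_trace,
    dotProduct_mulVec_eq_trace (v k), trace_mul_single]
  simp [mul_comm]

theorem HasRankOneKraus.adjoint {m n : ℕ} {Φ : Mat m →ₗ[ℂ] Mat n} (h : HasRankOneKraus Φ) :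
    HasRankOneKraus (adjoint Φ) := by
  obtain ⟨ι, _, v, w, hΦ⟩ := h
  exact ⟨ι, inferInstance, w, v, adjoint_apply_of_kraus hΦ⟩

theorem HasOrthonormalKraus.adjoint {m n : ℕ} {Φ : Mat m →ₗ[ℂ] Mat n}
    (h : HasOrthonormalKraus Φ) : HasOrthonormalKraus (adjoint Φ) := by
  obtain ⟨N, v, w, hv, hw, hΦ⟩ := h
  exact ⟨N, w, v, hw, hv, adjoint_apply_of_kraus hΦ⟩

theorem HasOrthonormalKraus.isDegradable {m n : ℕ} {Φ : Mat m →ₗ[ℂ] Mat n}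
    (h : HasOrthonormalKraus Φ) : IsDegradable Φ := by
  obtain ⟨N, v, w, -, hw, hΦ⟩ := h
  exact isDegradable_of_orthonormal hw hΦ

theorem trace_adjoint_mul {m n : ℕ} (Φ : Mat m →ₗ[ℂ] Mat n) (X : Mat n) (T : Mat m) :
    (adjoint Φ X * T).trace = (X * Φ T).trace :=
  (eq_adjoint_iff Φ _).mp rfl X T

theorem adjoint_adjoint {m n : ℕ} (Φ : Mat m →ₗ[ℂ] Mat n) : adjoint (adjoint Φ) = Φ :=
  ((eq_adjoint_iff (adjoint Φ) Φ).mpr fun X T => by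
    rw [trace_mul_comm, ← trace_adjoint_mul, trace_mul_comm]).symm

end EBMaps

theorem corollary4p2 (d : ℕ) (Φ : EBMaps.Mat d →ₗ[ℂ] EBMaps.Mat d)
    (hEB : EBMaps.IsEntanglementBreaking Φ)
    (hunital : Φ 1 = 1)
    (htrace : ∀ X : EBMaps.Mat d, (Φ X).trace = X.trace) :
    EBMaps.IsDegradable Φ ↔ EBMaps.IsDegradable (EBMaps.adjoint Φ) := by
  have hΦ := hEB.hasRankOneKraus
  have hunital' : EBMaps.adjoint Φ 1 = 1 :=
    Matrix.ext_iff_trace_mul_right.mpr fun T => by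
      rw [EBMaps.trace_adjoint_mul, one_mul, one_mul, htrace]
  have htrace' (X : EBMaps.Mat d) : (EBMaps.adjoint Φ X).trace = X.trace := by
    rw [← mul_one (EBMaps.adjoint Φ X), EBMaps.trace_adjoint_mul, hunital, mul_one]
  constructor
  · intro h
    exact (hΦ.hasOrthonormalKraus h hunital htrace).adjoint.isDegradable
  · intro h
    have := (hΦ.adjoint.hasOrthonormalKraus h hunital' htrace').adjoint.isDegradable
    rwa [EBMaps.adjoint_adjoint] at this
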